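/- Let $\mathbf k$ be a field, $R=\mathbf k[x_1,\dots,x_n]$, let $I\subseteq R$ be a monomial ideal, and let $G(I)$ be the set of its minimal monomial generators. Let $$\mathbb F:\ \cdots\xrightarrow{\delta_2} F_1\xrightarrow{\delta_1} F_0,\qquad F_i=\bigoplus_{j=1}^{r_i}R(-\mu_{i,j}),\quad r_i<\infty,\ \mu_{i,j}\in\mathbb N^n,$$ be a multigraded free resolution of $I$: each $\delta_i$ is $R$-linear of multidegree $0$, and there is an $R$-linear map $\varepsilon:F_0\to I$ of multidegree $0$ such that $\cdots\to F_1\to F_0\xrightarrow{\varepsilon} I\to 0$ is exact. Let $A_i=(a^i_{l,j})$ be the matrix of $\delta_i$ in the standard bases; thus each nonzero entry is $a^i_{l,j}=t\,\mathbf x^{\mu_{i,j}-\mu_{i-1,l}}$ with $0\ne t\in\mathbf k$. Let $a=(a_1,\dots,a_n)\in\mathbb N^n$ be such that the exponents of all monomials in $G(I)$ and all multidegrees $\mu_{i,j}$ are componentwise $\le a$. (If all $\mu_{i,j}$ are bounded by the vector of maximal exponents of the variables in $G(I)$, this vector may be taken as $a$.) Put $S=\mathbf k[x_{v,s}: 1\le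 v\le n,\ 1\le s\le a_v]$. For $b\in\mathbb N^n$ with $b\le a$, the polarization $\overline b\in\mathbb N^{a_1+\cdots+a_n}$ is the exponent of $\prod_{v=1}^n x_{v,1}\cdots x_{v,b_v}$. The polarization of $I$ with respect to $a$ is the ideal $I^P\subseteq S$ generated by the monomials $\mathbf x^{\overline m}$, $\mathbf x^m\in G(I)$. The polarization $\overline{\mathbb F}$ of $\mathbb F$ is the sequence of the modules $\overline F_i=\bigoplus_{j=1}^{r_i}S(-\overline{\mu}_{i,j})$ and of the maps $\overline\delta_i$ whose matrices are obtained from the $A_i$ by replacing each nonzero entry $t\,\mathbf x^{b-c}$, where $b=\mu_{i,j}$ and $c=\mu_{i-1,l}$, by $t\prod_{v=1}^n x_{v,c_v+1}\cdots x_{v,b_v}$, and by leaving the zero entries zero. Then $\overline{\mathbb F}$ is a multigraded free resolution of $I^P$. Moreover, for every $i$: 1. $\operatorname{rank}\overline F_i=\operatorname{rank}F_i$; 2. for every $d\in\mathbb N$, the numbers of $j$ such that $\overline\mu_{i,j}$, respectively $\mu_{i,j}$, has total degree $d$ are equal (equality of the graded ranks); 3. for every $\mu\in\mathbb N^n$ with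 $\mu\le a$, the number of $j$ with $\mu_{i,j}=\mu$ equals the number of $j$ with $\overline\mu_{i,j}=\overline\mu$ (the $(i,\mu)$-rank of $\mathbb F$ equals the $(i,\overline\mu)$-rank of $\overline{\mathbb F}$). -/

import Mathlib

noncomputable section

namespace Polarization

open MvPolynomial

variable {k : Type*} [Field k] {σ : Type*}

/-- An ideal of a polynomial ring is monomial if it is generated by a set of monomials. -/
def IsMonomialIdeal (I : Ideal (MvPolynomial σ k)) : Prop :=
  ∃ M : Set (σ →₀ ℕ), I = Ideal.span ((fun m => monomial m (1 : k)) '' M)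

/-- The exponents of the minimal monomial generators of a monomial ideal `I`, that is, of the
monomials of `I` that are minimal for divisibility. -/
def minGens (I : Ideal (MvPolynomial σ k)) : Set (σ →₀ ℕ) :=
  {m | Minimal (fun m' : σ →₀ ℕ => monomial m' (1 : k) ∈ I) m}

/-- The variables `x_{v,1}, …, x_{v,a_v}` of the polarized ring; `⟨v, s⟩` stands for
`x_{v,s+1}`. -/
abbrev PolVar {n : ℕ} (a : Fin n → ℕ) : Type := (v : Fin n) × Fin (a v)

/-- The polarization of an exponent `b` with respect to `a`: in the block of `v`, the first `b v`
entries are `1` and the remaining ones are `0`. It is meaningful when `b v ≤ a v` for all `v`. -/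
def polExp {n : ℕ} (a : Fin n → ℕ) (b : Fin n →₀ ℕ) : PolVar a →₀ ℕ :=
  Finsupp.equivFunOnFinite.symm fun p => if (p.2 : ℕ) < b p.1 then 1 else 0

/-- The exponent of `∏_v x_{v,c_v+1} ⋯ x_{v,b_v}`. -/
def polQuot {n : ℕ} (a : Fin n → ℕ) (b c : Fin n →₀ ℕ) : PolVar a →₀ ℕ :=
  Finsupp.equivFunOnFinite.symm fun p =>
    if c p.1 ≤ (p.2 : ℕ) ∧ (p.2 : ℕ) < b p.1 then 1 else 0

/-- The polarization of a monomial ideal with respect to `a`, generated by the polarizations of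
the minimal monomial generators. -/
def polIdeal {n : ℕ} (a : Fin n → ℕ) (I : Ideal (MvPolynomial (Fin n) k)) :
    Ideal (MvPolynomial (PolVar a) k) :=
  Ideal.span ((fun m => monomial (polExp a m) (1 : k)) '' minGens I)

variable (k σ) in
/-- A sequence `⋯ ⟶ F₂ ⟶ F₁ ⟶ F₀` of multigraded free modules of finite rank with chosen
homogeneous bases, `F_i = ⊕_{j < r i} R(-deg i j)`, `R = k[x_v : v ∈ σ]`. The map
`F_{i+1} ⟶ F_i` is given by the matrix `mat i`, whose `j`-th column is the image of the `j`-th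
basis element of `F_{i+1}`. No condition on the matrices is imposed here. -/
structure FreeSeq where
  /-- the number of basis elements of `F_i` -/
  r : ℕ → ℕ
  /-- the multidegrees of the basis elements -/
  deg : (i : ℕ) → Fin (r i) → (σ →₀ ℕ)
  /-- the matrix of `F_{i+1} ⟶ F_i` -/
  mat : (i : ℕ) → Matrix (Fin (r i)) (Fin (r (i + 1))) (MvPolynomial σ k)

namespace FreeSeq

/-- The free module `F_i`. -/
abbrev Mod (F : FreeSeq k σ) (i : ℕ) : Type _ := Fin (F.r i) → MvPolynomial σ k

/-- The differential `F_{i+1} ⟶ F_i`. -/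
def diff (F : FreeSeq k σ) (i : ℕ) : F.Mod (i + 1) →ₗ[MvPolynomial σ k] F.Mod i :=
  (F.mat i).mulVecLin

/-- The differentials have multidegree `0`: every term `c · x^d` of the `(l, j)` entry of the matrix
of `F_{i+1} ⟶ F_i` satisfies `d + deg i l = deg (i + 1) j`. -/
def DiffHomogeneous (F : FreeSeq k σ) : Prop :=
  ∀ (i : ℕ) (l : Fin (F.r i)) (j : Fin (F.r (i + 1))), ∀ d ∈ (F.mat i l j).support,
    d + F.deg i l = F.deg (i + 1) j

/-- `F` is a multigraded free chain complex: differentials of multidegree `0` and square `0`. -/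
def IsMultigradedComplex (F : FreeSeq k σ) : Prop :=
  F.DiffHomogeneous ∧ ∀ i, F.diff i ∘ₗ F.diff (i + 1) = 0

/-- `F` is a multigraded free resolution of `I`: it is a multigraded complex, and for some
`R`-linear `ε : F₀ ⟶ I` of multidegree `0` the sequence `⋯ ⟶ F₁ ⟶ F₀ ⟶ I ⟶ 0` is exact. -/
def IsMultigradedResolution (F : FreeSeq k σ) (I : Ideal (MvPolynomial σ k)) : Prop :=
  F.IsMultigradedComplex ∧
  (∀ i, Function.Exact (F.diff (i + 1)) (F.diff i)) ∧
  ∃ ε : F.Mod 0 →ₗ[MvPolynomial σ k] I,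
    (∀ j, ∀ d ∈ (ε (Pi.single j 1) : MvPolynomial σ k).support, d = F.deg 0 j) ∧
    Function.Exact (F.diff 0) ε ∧ Function.Surjective ε

/-- The rank of `F_i`. -/
def rank (F : FreeSeq k σ) (i : ℕ) : ℕ := Module.finrank (MvPolynomial σ k) (F.Mod i)

/-- The `(i, d)`-graded rank: the number of summands of `F_i` generated in total degree `d`. -/
def gradedRank (F : FreeSeq k σ) (i d : ℕ) : ℕ :=
  Nat.card {j : Fin (F.r i) // (F.deg i j).degree = d}

/-- The `(i, μ)`-rank: the number of summands `R(-μ)` of `F_i`. -/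
def multigradedRank (F : FreeSeq k σ) (i : ℕ) (μ : σ →₀ ℕ) : ℕ :=
  Nat.card {j : Fin (F.r i) // F.deg i j = μ}

/-- The polarization of `F` with respect to `a`: the multidegrees are polarized, and an entry
`t · x^(b - c)`, `t ∈ k`, of a matrix between basis elements of multidegrees `b` and `c` becomes
`t · ∏_v x_{v,c_v+1} ⋯ x_{v,b_v}` (in particular `0` becomes `0`). -/
def polarize {n : ℕ} (a : Fin n → ℕ) (F : FreeSeq k (Fin n)) : FreeSeq k (PolVar a) where
  r := F.r
  deg i j := polExp a (F.deg i j)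
  mat i := Matrix.of fun l j =>
    monomial (polQuot a (F.deg (i + 1) j) (F.deg i l))
      (coeff (F.deg (i + 1) j - F.deg i l) (F.mat i l j))

end FreeSeq

end Polarization

end

noncomputable section

namespace Polarization

open MvPolynomial

/-! ### Exactness of multigraded sequences, degree by degree -/

section Strands

variable {k : Type*} [Field k] {σ : Type*} {α β γ : Type*}

/-! A multigraded map of free modules is a scalar matrix together with the degrees of the basis
elements. Its strand in degree `d` is that scalar matrix restricted to the basis elements of degree
`≤ d`, so exactness is a family of linear algebra statements over `k`, one for each `d`
(`exact_iff_strandExact`).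

Polarization keeps the scalar matrices and changes only the degrees. For `b ≤ a`, `polExp a b ≤ e`
holds iff `b ≤ leadingRun e` (`polExp_le_iff`). So the strand of the polarized sequence in degree
`e` is the original strand in degree `leadingRun e`, and exactness carries over
(`StrandExact.polExp`).

The augmentation is handled in the same way, as a one-row matrix with target degree `0`. Its image
is `polIdeal a I` because each minimal generator must be, up to a scalar, the image of a basis
element. The rank equalities hold because polarizing exponents `≤ a` is injective and preserves
total degree. -/

/-- The homogeneous matrix with scalar coefficients `C`, between free modules whose basis elements
have multidegrees `dl` (rows) and `dj` (columns). -/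
def homMatrix (dl : α → σ →₀ ℕ) (dj : β → σ →₀ ℕ) (C : Matrix α β k) :
    Matrix α β (MvPolynomial σ k) :=
  Matrix.of fun l j => monomial (dj j - dl l) (C l j)

/-- The coordinates of the component of multidegree `d` of an element of a free module. -/
def component (dj : β → σ →₀ ℕ) (d : σ →₀ ℕ) (x : β → MvPolynomial σ k) : β → k :=
  open Classical in fun j => if dj j ≤ d then coeff (d - dj j) (x j) else 0

/-- The homogeneous element of multidegree `d` with coordinates `w`. -/
def homElement (dj : β → σ →₀ ℕ) (d : σ →₀ ℕ) (w : β → k) : β → MvPolynomial σ k :=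
  fun j => monomial (d - dj j) (w j)

/-- Exactness in every multidegree of the sequence with scalar matrices `A` and `B`. -/
def StrandExact [Fintype α] [Fintype β] (da : α → σ →₀ ℕ) (db : β → σ →₀ ℕ)
    (A : Matrix β α k) (B : Matrix γ β k) : Prop :=
  ∀ d : σ →₀ ℕ, ∀ w : β → k, (∀ j, w j ≠ 0 → db j ≤ d) →
    (B.mulVec w = 0 ↔ ∃ u : α → k, (∀ j, u j ≠ 0 → da j ≤ d) ∧ A.mulVec u = w)

lemma component_ne_zero {dj : β → σ →₀ ℕ} {d : σ →₀ ℕ} {x : β → MvPolynomial σ k} {j : β}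
    (h : component dj d x j ≠ 0) : dj j ≤ d := by
  by_contra h'
  exact h (by simp [component, h'])

lemma component_homElement {dj : β → σ →₀ ℕ} {d : σ →₀ ℕ} {w : β → k}
    (hw : ∀ j, w j ≠ 0 → dj j ≤ d) : component dj d (homElement dj d w) = w := by
  classical
  funext j
  by_cases h : dj j ≤ d
  · simp [component, homElement, h]
  · have : w j = 0 := by
      by_contra h'
      exact h (hw j h')
    simp [component, h, this]

lemma eq_zero_of_component_eq_zero {dj : β → σ →₀ ℕ} {x : β → MvPolynomial σ k}
    (h : ∀ d, component dj d x = 0) : x = 0 := by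
  classical
  funext j
  ext m
  have := congrFun (h (m + dj j)) j
  simpa [component] using this

variable [Fintype β]

/-- `hC` ensures that the truncated subtraction `dj j - dl l` is a true difference wherever the
coefficient is nonzero. -/
lemma component_mulVec {dl : α → σ →₀ ℕ} {dj : β → σ →₀ ℕ} {C : Matrix α β k}
    (hC : ∀ l j, C l j ≠ 0 → dl l ≤ dj j) (d : σ →₀ ℕ) (x : β → MvPolynomial σ k) :
    component dl d ((homMatrix dl dj C).mulVec x) = C.mulVec (component dj d x) := by
  classical
  funext l
  simp only [component, Matrix.mulVec, dotProduct, homMatrix, Matrix.of_apply, coeff_sum,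
    coeff_monomial_mul']
  by_cases hl : dl l ≤ d
  · rw [if_pos hl]
    refine Finset.sum_congr rfl fun j _ => ?_
    by_cases hc : C l j = 0
    · simp [hc]
    have hlj := hC l j hc
    have key : dj j - dl l ≤ d - dl l ↔ dj j ≤ d := tsub_le_tsub_iff_right hl
    by_cases hj : dj j ≤ d
    · rw [if_pos (key.2 hj), if_pos hj, tsub_tsub_tsub_cancel_right hlj]
    · rw [if_neg (mt key.1 hj), if_neg hj, mul_zero]
  · rw [if_neg hl, eq_comm]
    refine Finset.sum_eq_zero fun j _ => ?_
    by_cases hc : C l j = 0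
    · simp [hc]
    · rw [if_neg fun hj => hl ((hC l j hc).trans hj), mul_zero]

lemma mulVec_homElement {dl : α → σ →₀ ℕ} {dj : β → σ →₀ ℕ} {C : Matrix α β k}
    (hC : ∀ l j, C l j ≠ 0 → dl l ≤ dj j) {d : σ →₀ ℕ} {w : β → k}
    (hw : ∀ j, w j ≠ 0 → dj j ≤ d) :
    (homMatrix dl dj C).mulVec (homElement dj d w) = homElement dl d (C.mulVec w) := by
  funext l
  simp only [homElement, Matrix.mulVec, dotProduct, homMatrix, Matrix.of_apply, map_sum,
    monomial_mul]
  refine Finset.sum_congr rfl fun j _ => ?_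
  by_cases hc : C l j = 0
  · simp [hc]
  by_cases hwj : w j = 0
  · simp [hwj]
  rw [add_comm, tsub_add_tsub_cancel (hw j hwj) (hC l j hc)]

lemma exists_sum_homElement (dj : β → σ →₀ ℕ) (x : β → MvPolynomial σ k) :
    ∃ D : Finset (σ →₀ ℕ), ∑ d ∈ D, homElement dj d (component dj d x) = x := by
  classical
  -- A term `x^m` in coordinate `j` lives in multidegree `m + dj j`; only finitely many of these
  -- occur.
  refine ⟨Finset.univ.biUnion fun j => (x j).support.image (· + dj j), ?_⟩
  funext j
  ext m
  simp only [Finset.sum_apply, homElement, component, coeff_sum, coeff_monomial]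
  rw [Finset.sum_eq_single (m + dj j)]
  · simp
  · intro d _ hd
    by_cases h : dj j ≤ d
    · rw [if_neg]
      rintro rfl
      exact hd (tsub_add_cancel_of_le h).symm
    · simp [h]
  · intro h
    by_contra h'
    refine h (Finset.mem_biUnion.2 ⟨j, Finset.mem_univ _, Finset.mem_image.2 ⟨m, ?_, rfl⟩⟩)
    rw [mem_support_iff]
    simpa using h'

/-- Homogeneous elements of degree `d` correspond to scalar vectors supported on basis elements of
degree `≤ d`, and the maps commute with taking components. -/
lemma exact_iff_strandExact [Fintype α] {da : α → σ →₀ ℕ} {db : β → σ →₀ ℕ}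
    {dc : γ → σ →₀ ℕ} {A : Matrix β α k} {B : Matrix γ β k}
    (hA : ∀ l j, A l j ≠ 0 → db l ≤ da j) (hB : ∀ l j, B l j ≠ 0 → dc l ≤ db j) :
    Function.Exact (homMatrix db da A).mulVecLin (homMatrix dc db B).mulVecLin ↔
      StrandExact da db A B := by
  constructor
  · intro h d w hw
    have hker : B.mulVec w = 0 ↔
        (homMatrix dc db B).mulVecLin (homElement db d w) = 0 := by
      rw [Matrix.mulVecLin_apply]
      constructor
      · intro h0
        rw [mulVec_homElement hB hw, h0]
        funext l
        simp [homElement]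
      · intro h0
        rw [← component_homElement hw, ← component_mulVec hB, h0]
        funext l
        simp [component]
    rw [hker, h (homElement db d w)]
    constructor
    · rintro ⟨x, hx⟩
      refine ⟨component da d x, fun j => component_ne_zero, ?_⟩
      rw [← component_mulVec hA, ← Matrix.mulVecLin_apply, hx, component_homElement hw]
    · rintro ⟨u, hu, rfl⟩
      exact ⟨homElement da d u, by rw [Matrix.mulVecLin_apply, mulVec_homElement hA hu]⟩
  · intro h x
    constructor
    · intro hx
      have hex : ∀ d, ∃ u : α → k, (∀ j, u j ≠ 0 → da j ≤ d) ∧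
          A.mulVec u = component db d x := fun d =>
        (h d _ fun j => component_ne_zero).1 <| by
          rw [← component_mulVec hB, ← Matrix.mulVecLin_apply, hx]
          funext l
          simp [component]
      choose u hu hux using hex
      obtain ⟨D, hD⟩ := exists_sum_homElement db x
      -- A preimage is assembled from preimages of the finitely many homogeneous components of `x`.
      refine ⟨∑ d ∈ D, homElement da d (u d), ?_⟩
      refine (map_sum _ _ _).trans (Eq.trans (Finset.sum_congr rfl fun d _ => ?_) hD)
      rw [Matrix.mulVecLin_apply, mulVec_homElement hA (hu d), hux]
    · rintro ⟨y, rfl⟩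
      refine eq_zero_of_component_eq_zero (dj := dc) fun d => ?_
      rw [Matrix.mulVecLin_apply, Matrix.mulVecLin_apply, component_mulVec hB,
        component_mulVec hA]
      refine (h d _ ?_).2 ⟨component da d y, fun j => component_ne_zero, rfl⟩
      rw [← component_mulVec hA]
      exact fun j => component_ne_zero

end Strands

/-! ### Polarized exponents and their order -/

section Exponents

variable {n : ℕ} {a : Fin n → ℕ}

lemma polExp_apply (a : Fin n → ℕ) (b : Fin n →₀ ℕ) (p : PolVar a) :
    polExp a b p = if (p.2 : ℕ) < b p.1 then 1 else 0 := rfl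

lemma polExp_sub_polExp (a : Fin n → ℕ) (b c : Fin n →₀ ℕ) :
    polExp a b - polExp a c = polQuot a b c := by
  ext p
  change polExp a b p - polExp a c p = if c p.1 ≤ (p.2 : ℕ) ∧ (p.2 : ℕ) < b p.1 then 1 else 0
  rw [polExp_apply, polExp_apply]
  split_ifs <;> omega

lemma polExp_mono (a : Fin n → ℕ) : Monotone (polExp a) := by
  intro b c h p
  have := h p.1
  rw [polExp_apply, polExp_apply]
  split_ifs <;> omega

lemma polExp_degree {b : Fin n →₀ ℕ} (hb : ∀ v, b v ≤ a v) :
    (polExp a b).degree = b.degree := by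
  rw [Finsupp.degree_eq_sum, Finsupp.degree_eq_sum, Fintype.sum_sigma]
  refine Finset.sum_congr rfl fun v _ => ?_
  simp only [polExp_apply]
  rw [Fin.sum_univ_eq_sum_range (fun s => if s < b v then 1 else 0) (a v),
    ← Finset.card_filter]
  have : (Finset.range (a v)).filter (· < b v) = Finset.range (b v) := by
    ext s
    have := hb v
    simp only [Finset.mem_filter, Finset.mem_range]
    omega
  rw [this, Finset.card_range]

/-- The lengths of the longest initial runs of nonzero entries in the blocks of `e`. -/
def leadingRun (e : PolVar a →₀ ℕ) : Fin n →₀ ℕ :=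
  open Classical in
  Finsupp.equivFunOnFinite.symm fun v =>
    Nat.findGreatest (fun c => ∀ s : Fin (a v), (s : ℕ) < c → e ⟨v, s⟩ ≠ 0) (a v)

/-- A polarized exponent fills an initial segment of each block, so only the initial run of `e`
there matters. -/
lemma polExp_le_iff {b : Fin n →₀ ℕ} (hb : ∀ v, b v ≤ a v) (e : PolVar a →₀ ℕ) :
    polExp a b ≤ e ↔ b ≤ leadingRun e := by
  classical
  constructor
  · intro h v
    refine Nat.le_findGreatest (hb v) fun s hs h0 => ?_
    have := h ⟨v, s⟩
    rw [polExp_apply, if_pos hs, h0] at this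
    omega
  · rintro h ⟨v, s⟩
    have hv : b v ≤ Nat.findGreatest
        (fun c => ∀ s : Fin (a v), (s : ℕ) < c → e ⟨v, s⟩ ≠ 0) (a v) := by
      convert h v using 1
      simp only [leadingRun, Finsupp.equivFunOnFinite_symm_apply_apply]
    have hspec := Nat.findGreatest_spec
      (P := fun c => ∀ s : Fin (a v), (s : ℕ) < c → e ⟨v, s⟩ ≠ 0) (Nat.zero_le (a v))
      (fun _ hs => absurd hs (Nat.not_lt_zero _))
    rw [polExp_apply]
    split_ifs with hs
    · exact Nat.one_le_iff_ne_zero.2 (hspec s (lt_of_lt_of_le hs hv))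
    · exact Nat.zero_le _

lemma polExp_le_polExp_iff {b c : Fin n →₀ ℕ} (hb : ∀ v, b v ≤ a v) :
    polExp a b ≤ polExp a c ↔ b ≤ c := by
  refine ⟨fun h v => ?_, fun h => polExp_mono a h⟩
  by_contra! hlt
  -- The variable `x_{v,c_v+1}` divides the polarization of `b` but not that of `c`.
  have := h ⟨v, ⟨c v, hlt.trans_le (hb v)⟩⟩
  simp only [polExp_apply, if_pos hlt, lt_irrefl, if_false] at this
  omega

lemma polExp_eq_polExp_iff {b c : Fin n →₀ ℕ} (hb : ∀ v, b v ≤ a v) (hc : ∀ v, c v ≤ a v) :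
    polExp a b = polExp a c ↔ b = c := by
  rw [le_antisymm_iff, le_antisymm_iff, polExp_le_polExp_iff hb, polExp_le_polExp_iff hc]

lemma StrandExact.polExp {k : Type*} [Field k] {α β γ : Type*} [Fintype α] [Fintype β]
    {da : α → Fin n →₀ ℕ} {db : β → Fin n →₀ ℕ} {A : Matrix β α k} {B : Matrix γ β k}
    (h : StrandExact da db A B) (hda : ∀ j v, da j v ≤ a v) (hdb : ∀ j v, db j v ≤ a v) :
    StrandExact (fun j => polExp a (da j)) (fun j => polExp a (db j)) A B := by
  intro e w hw
  simp only [polExp_le_iff (hda _), polExp_le_iff (hdb _)] at hw ⊢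
  exact h (leadingRun e) w hw

end Exponents

/-! ### Monomials in an ideal and in its polarization -/

section MonomialIdeals

variable {k : Type*} [Field k] {σ : Type*}

lemma monomial_mem_of_le {I : Ideal (MvPolynomial σ k)} {m m' : σ →₀ ℕ}
    (h : monomial m (1 : k) ∈ I) (hm : m ≤ m') (t : k) : monomial m' t ∈ I := by
  have := I.mul_mem_left (monomial (m' - m) t) h
  rwa [monomial_mul, tsub_add_cancel_of_le hm, mul_one] at this

lemma monomial_one_mem {I : Ideal (MvPolynomial σ k)} {m : σ →₀ ℕ} {t : k} (ht : t ≠ 0)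
    (h : monomial m t ∈ I) : monomial m (1 : k) ∈ I := by
  have := I.mul_mem_left (C t⁻¹) h
  rwa [C_mul_monomial, inv_mul_cancel₀ ht] at this

lemma exists_minGens_le [Finite σ] {I : Ideal (MvPolynomial σ k)} {m : σ →₀ ℕ}
    (h : monomial m (1 : k) ∈ I) : ∃ m' ∈ minGens I, m' ≤ m := by
  obtain ⟨m', hle, hm'⟩ := exists_minimal_le_of_wellFoundedLT
    (fun m' : σ →₀ ℕ => monomial m' (1 : k) ∈ I) m h
  exact ⟨m', hm', hle⟩

lemma polExp_mem_polIdeal {n : ℕ} (a : Fin n → ℕ) {I : Ideal (MvPolynomial (Fin n) k)}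
    {m : Fin n →₀ ℕ} (h : monomial m (1 : k) ∈ I) (t : k) :
    monomial (polExp a m) t ∈ polIdeal a I := by
  obtain ⟨m', hm', hle⟩ := exists_minGens_le h
  have hgen : monomial (polExp a m') (1 : k) ∈ polIdeal a I :=
    Ideal.subset_span ⟨m', hm', rfl⟩
  exact monomial_mem_of_le hgen (polExp_mono a hle) t

end MonomialIdeals

/-! ### The augmentation as a one-row matrix -/

section Augmentation

variable {k : Type*} [Field k] {σ : Type*} {β : Type*} [Fintype β]

/-- The map to the polynomial ring that sends the `j`-th basis element to `c j • x ^ (d j)`. -/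
def augMap (d : β → σ →₀ ℕ) (c : β → k) :
    (β → MvPolynomial σ k) →ₗ[MvPolynomial σ k] MvPolynomial σ k :=
  LinearMap.proj (0 : Fin 1) ∘ₗ
    (homMatrix (fun _ => 0) d (Matrix.of fun (_ : Fin 1) j => c j)).mulVecLin

lemma augMap_apply (d : β → σ →₀ ℕ) (c : β → k) (x : β → MvPolynomial σ k) :
    augMap d c x = ∑ j, monomial (d j) (c j) * x j := by
  simp [augMap, homMatrix, Matrix.mulVec, dotProduct]

lemma augMap_single [DecidableEq β] (d : β → σ →₀ ℕ) (c : β → k) (j : β) :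
    augMap d c (Pi.single j 1) = monomial (d j) (c j) := by
  rw [augMap_apply, Finset.sum_eq_single j] <;> simp +contextual

lemma exact_augMap_iff {α : Type*} [Fintype α] {da : α → σ →₀ ℕ} {d : β → σ →₀ ℕ}
    {A : Matrix β α k} {c : β → k} (hA : ∀ l j, A l j ≠ 0 → d l ≤ da j) :
    Function.Exact (homMatrix d da A).mulVecLin (augMap d c) ↔
      StrandExact da d A (Matrix.of fun (_ : Fin 1) j => c j) := by
  rw [← exact_iff_strandExact (dc := fun _ => 0) hA fun _ _ _ => zero_le]
  refine forall_congr' fun x => ?_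
  have : augMap d c x = 0 ↔
      (homMatrix (fun _ => 0) d (Matrix.of fun (_ : Fin 1) j => c j)).mulVecLin x = 0 := by
    rw [funext_iff, Fin.forall_fin_one]
    rfl
  rw [this]

end Augmentation

/-! ### Polarizing resolutions -/

namespace FreeSeq

variable {k : Type*} [Field k] {σ : Type*}

/-- The scalar coefficients of the matrices of the differentials. -/
def scalar (F : FreeSeq k σ) (i : ℕ) : Matrix (Fin (F.r i)) (Fin (F.r (i + 1))) k :=
  Matrix.of fun l j => coeff (F.deg (i + 1) j - F.deg i l) (F.mat i l j)

lemma scalar_ne_zero {F : FreeSeq k σ} (hF : F.DiffHomogeneous) (i : ℕ)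
    (l : Fin (F.r i)) (j : Fin (F.r (i + 1))) (h : F.scalar i l j ≠ 0) :
    F.deg i l ≤ F.deg (i + 1) j := by
  rw [← hF i l j _ (mem_support_iff.2 h)]
  exact le_add_self

/-- Homogeneity leaves at most one possible exponent in each entry. -/
lemma diff_eq {F : FreeSeq k σ} (hF : F.DiffHomogeneous) (i : ℕ) :
    F.diff i = (homMatrix (F.deg i) (F.deg (i + 1)) (F.scalar i)).mulVecLin := by
  classical
  unfold diff
  congr 1
  ext l j m
  simp only [homMatrix, scalar, Matrix.of_apply, coeff_monomial]
  split_ifs with h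
  · rw [h]
  · by_contra h'
    have := hF i l j m (mem_support_iff.2 h')
    exact h (by rw [← this, add_tsub_cancel_right])

variable {n : ℕ}

lemma diff_polarize (a : Fin n → ℕ) (F : FreeSeq k (Fin n)) (i : ℕ) :
    (F.polarize a).diff i = (homMatrix (fun l => polExp a (F.deg i l))
      (fun j => polExp a (F.deg (i + 1) j)) (F.scalar i)).mulVecLin := by
  unfold diff
  congr 1
  ext1 l j
  simp only [homMatrix, polExp_sub_polExp]
  rfl

lemma polarize_diffHomogeneous {F : FreeSeq k (Fin n)} (hF : F.DiffHomogeneous)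
    (a : Fin n → ℕ) : (F.polarize a).DiffHomogeneous := by
  classical
  intro i l j d hd
  change d ∈ (monomial (polQuot a (F.deg (i + 1) j) (F.deg i l)) (F.scalar i l j)).support at hd
  rw [support_monomial] at hd
  split_ifs at hd with h
  · simp at hd
  · rw [Finset.mem_singleton.1 hd, ← polExp_sub_polExp]
    exact tsub_add_cancel_of_le (polExp_mono a (scalar_ne_zero hF i l j h))

/-- The polarization of a multigraded free resolution of an ideal `I` is a multigraded free
resolution of the polarization of `I`. -/
lemma IsMultigradedResolution.polarize {I : Ideal (MvPolynomial (Fin n) k)}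
    {F : FreeSeq k (Fin n)} (hF : F.IsMultigradedResolution I) {a : Fin n → ℕ}
    (haF : ∀ i j v, F.deg i j v ≤ a v) :
    (F.polarize a).IsMultigradedResolution (polIdeal a I) := by
  classical
  obtain ⟨⟨hhom, -⟩, hex, ε, hε, hεex, hεsurj⟩ := hF
  have hC := fun i => scalar_ne_zero hhom i
  have hCp : ∀ i l j, F.scalar i l j ≠ 0 → polExp a (F.deg i l) ≤ polExp a (F.deg (i + 1) j) :=
    fun i l j h => polExp_mono a (hC i l j h)
  have hexp : ∀ i, Function.Exact ((F.polarize a).diff (i + 1)) ((F.polarize a).diff i) := by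
    intro i
    have h := hex i
    rw [diff_eq hhom, diff_eq hhom, exact_iff_strandExact (hC _) (hC _)] at h
    rw [diff_polarize, diff_polarize]
    exact (exact_iff_strandExact (hCp _) (hCp _)).2 (h.polExp (haF _) (haF _))
  refine ⟨⟨polarize_diffHomogeneous hhom a, fun i => (hexp i).linearMap_comp_eq_zero⟩, hexp, ?_⟩
  let c : Fin (F.r 0) → k := fun j => coeff (F.deg 0 j) (ε (Pi.single j 1) : MvPolynomial _ k)
  have hεmon : ∀ j, (ε (Pi.single j 1) : MvPolynomial _ k) = monomial (F.deg 0 j) (c j) := by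
    intro j
    ext m
    rw [coeff_monomial]
    split_ifs with h
    · rw [← h]
    · by_contra h'
      exact h (hε j m (mem_support_iff.2 h')).symm
  have hεaug : ∀ x, (ε x : MvPolynomial _ k) = augMap (F.deg 0) c x := by
    have : I.subtype ∘ₗ ε = augMap (F.deg 0) c := by
      refine LinearMap.pi_ext' fun j => LinearMap.ext_ring ?_
      simpa [augMap_single] using hεmon j
    exact fun x => LinearMap.congr_fun this x
  have hcI : ∀ j, c j ≠ 0 → monomial (F.deg 0 j) (1 : k) ∈ I := fun j hj =>
    monomial_one_mem hj (hεmon j ▸ (ε (Pi.single j 1)).2)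
  have hstrand : StrandExact (F.deg 1) (F.deg 0) (F.scalar 0)
      (Matrix.of fun (_ : Fin 1) j => c j) := by
    rw [← exact_augMap_iff (hC 0), ← diff_eq hhom]
    intro x
    rw [← hεaug, ZeroMemClass.coe_eq_zero]
    exact hεex x
  have hmem : ∀ x, augMap (fun j => polExp a (F.deg 0 j)) c x ∈ polIdeal a I := by
    intro x
    rw [augMap_apply]
    refine sum_mem fun j _ => Ideal.mul_mem_right _ _ ?_
    by_cases hj : c j = 0
    · simp [hj]
    · exact polExp_mem_polIdeal a (hcI j hj) _
  suffices h : ∃ ε' : (Fin (F.r 0) → MvPolynomial (PolVar a) k)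
      →ₗ[MvPolynomial (PolVar a) k] polIdeal a I,
      (∀ j, ∀ d ∈ (ε' (Pi.single j 1) : MvPolynomial (PolVar a) k).support,
        d = polExp a (F.deg 0 j)) ∧
      Function.Exact (homMatrix (fun l => polExp a (F.deg 0 l))
        (fun j => polExp a (F.deg 1 j)) (F.scalar 0)).mulVecLin ε' ∧
      Function.Surjective ε' by
    obtain ⟨ε', h₁, h₂, h₃⟩ := h
    refine ⟨ε', h₁, ?_, h₃⟩
    rw [diff_polarize]
    exact h₂
  refine ⟨LinearMap.codRestrict _ (augMap (fun j => polExp a (F.deg 0 j)) c) hmem, ?_, ?_, ?_⟩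
  · intro j d hd
    rw [LinearMap.codRestrict_apply, augMap_single] at hd
    exact Finset.mem_singleton.1 (support_monomial_subset hd)
  · have h := (exact_augMap_iff (hCp 0)).2 (hstrand.polExp (haF _) (haF _))
    intro x
    rw [← h x, ← ZeroMemClass.coe_eq_zero, LinearMap.codRestrict_apply]
  · rw [← LinearMap.range_eq_top, LinearMap.range_codRestrict, Submodule.comap_subtype_eq_top]
    refine Ideal.span_le.2 ?_
    rintro _ ⟨m, hm, rfl⟩
    obtain ⟨x, hx⟩ := hεsurj ⟨monomial m 1, hm.1⟩
    have hxm : coeff m (augMap (F.deg 0) c x) = 1 := by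
      rw [← hεaug, hx, coeff_monomial, if_pos rfl]
    rw [augMap_apply, coeff_sum] at hxm
    -- Some basis element contributes to the coefficient of `x^m`. Its image is a nonzero multiple
    -- of a monomial of `I` dividing `x^m`, hence of `x^m` itself by minimality.
    obtain ⟨j, -, hj⟩ := Finset.exists_ne_zero_of_sum_ne_zero (hxm.trans_ne one_ne_zero)
    rw [coeff_monomial_mul'] at hj
    split_ifs at hj with hle
    · have hcj : c j ≠ 0 := left_ne_zero_of_mul hj
      have hdeg : F.deg 0 j = m := le_antisymm hle (hm.2 (hcI j hcj) hle)
      refine ⟨Pi.single j (C (c j)⁻¹), ?_⟩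
      rw [augMap_apply, Finset.sum_eq_single j (fun i _ hi => by simp [hi]) (by simp),
        Pi.single_eq_same, mul_comm, C_mul_monomial, inv_mul_cancel₀ hcj, hdeg]
    · exact absurd rfl hj

end FreeSeq

end Polarization

end

theorem proposition3p12 {k : Type*} [Field k] {n : ℕ}
    (I : Ideal (MvPolynomial (Fin n) k)) (hI : Polarization.IsMonomialIdeal I)
    (F : Polarization.FreeSeq k (Fin n)) (hF : F.IsMultigradedResolution I)
    (a : Fin n → ℕ)
    (haI : ∀ m ∈ Polarization.minGens I, ∀ v, m v ≤ a v)
    (haF : ∀ i j v, F.deg i j v ≤ a v) :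
    (F.polarize a).IsMultigradedResolution (Polarization.polIdeal a I) ∧
    (∀ i, (F.polarize a).rank i = F.rank i) ∧
    (∀ i d, (F.polarize a).gradedRank i d = F.gradedRank i d) ∧
    (∀ i (μ : Fin n →₀ ℕ), (∀ v, μ v ≤ a v) →
      F.multigradedRank i μ =
        (F.polarize a).multigradedRank i (Polarization.polExp a μ)) := by
  refine ⟨hF.polarize haF, fun i => ?_, fun i d => ?_, fun i μ hμ => ?_⟩
  · simp only [Polarization.FreeSeq.rank, Module.finrank_fin_fun]
    rfl
  · refine Nat.card_congr (Equiv.subtypeEquivRight fun j => ?_)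
    rw [← Polarization.polExp_degree (haF i j)]
    rfl
  · exact Nat.card_congr (Equiv.subtypeEquivRight fun j =>
      (Polarization.polExp_eq_polExp_iff (haF i j) hμ).symm)
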